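/- Let $P$ be a countable set of propositional variables with a fixed numbering $P\hookrightarrow\mathbb N$. Formulas are built from $P$ with $\neg,\to,\vee,\wedge$ and two unary connectives $\blacktriangle,\triangledown$. The logic IntGC (intuitionistic propositional logic with a Galois connection) is the smallest set of formulas (the *provable* ones) that contains intuitionistic propositional logic and is closed under substitution, modus ponens, and the rules: from $A\to\triangledown B$ infer $\blacktriangle A\to B$; from $\blacktriangle A\to B$ infer $A\to\triangledown B$. An *IntGC-model* $\mathcal M=(X,\le,R,v)$ consists of a non-empty set $X$, a preorder $\le$ on $X$, a relation $R$ on $X$ such that $x\ge y$, $y\,R\,z$, $z\ge w$ imply $x\,R\,w$, and a map $v$ assigning to each $p\in P$ a $\le$-upward closed subset $v(p)\subseteq X$. Satisfaction is given by $x\models p$ iff $x\in v(p)$; the usual clauses for $\wedge,\vee$; $x\models A\to B$ iff for all $y\ge x$, $y\models A$ implies $y\models B$; $x\models\neg A$ iff $y\not\models A$ for all $y\ge x$; $x\models\blacktriangle A$ iff there is $y$ with $x\,R\,y$ and $y\models A$; $x\models\triangledown A$ iff $y\models A$ for all $y$ with $y\,R\,x$. A formula is *valid* in $\mathcal M$ if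 all $x\in X$ satisfy it. For a formula $A$ let $\mathrm{Sub}(A)$ be the set of its subformulas, put $\Gamma=\mathrm{Sub}(A)\cup\{\triangledown\blacktriangle B\mid\blacktriangle B\in\mathrm{Sub}(A)\}\cup\{\blacktriangle\triangledown B\mid\triangledown B\in\mathrm{Sub}(A)\}$, and let $\Sigma_A$ consist of $\mathrm{Sub}(A)$ and of all formulas $(\triangledown\blacktriangle)^n\triangledown B$, $\blacktriangle(\triangledown\blacktriangle)^n\triangledown B$ with $n\ge0$, $\triangledown B\in\Gamma$, and $(\blacktriangle\triangledown)^n\blacktriangle B$, $\triangledown(\blacktriangle\triangledown)^n\blacktriangle B$ with $n\ge0$, $\blacktriangle B\in\Gamma$. The *filtration* $\mathcal M^f$ of a model $\mathcal M$ through a set $\Sigma$ of formulas is the model on the classes $[x]$ of worlds satisfying the same formulas of $\Sigma$, where $[x]\le^f[y]$ iff every $B\in\Sigma$ with $x\models B$ has $y\models B$; $[x]\,R^f\,[y]$ iff for every $B\in\Sigma$ with $\triangledown B\in\Sigma$, $y\models\triangledown B$ implies $x\models B$; and $v^f(p)=\{[x]\mid x\models p\}$ for $p\in\Sigma$, $v^f(p)=\emptyset$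 for the other variables. Then: 1. (Finite model property) Every formula that is not provable in IntGC fails to be valid in some finite IntGC-model. 2. For every formula $A$: $A\in\Sigma_A$; $\Sigma_A$ is closed under subformulas; $\Sigma_A$ splits into only finitely many classes of provably equivalent formulas; and whenever $A$ is not valid in an IntGC-model $\mathcal M$, the filtration of $\mathcal M$ through $\Sigma_A$ is a finite IntGC-model in which $A$ is not valid. 3. IntGC is decidable: there is a total computable function which, given the Gödel number of a formula, decides whether the formula is provable. -/

import Mathlib

universe u v

namespace IntGC

/-- Formulas over a set `P` of propositional variables.  The connectives are `¬`, `→`, `∨`, `∧`,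
`▲` (`up`) and `▽` (`down`). -/
inductive Formula (P : Type u) : Type u
  | var : P → Formula P
  | neg : Formula P → Formula P
  | imp : Formula P → Formula P → Formula P
  | disj : Formula P → Formula P → Formula P
  | conj : Formula P → Formula P → Formula P
  | up : Formula P → Formula P
  | down : Formula P → Formula P

namespace Formula

variable {P : Type u}

/-- `A ↔ B`, i.e. `(A → B) ∧ (B → A)`. -/
def equiv (A B : Formula P) : Formula P := conj (imp A B) (imp B A)

/-- Simultaneous substitution of formulas for variables. -/
def subst (s : P → Formula P) : Formula P → Formula P
  | var p => s p
  | neg A => neg (subst s A)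
  | imp A B => imp (subst s A) (subst s B)
  | disj A B => disj (subst s A) (subst s B)
  | conj A B => conj (subst s A) (subst s B)
  | up A => up (subst s A)
  | down A => down (subst s A)

/-- The set `Sub(A)` of subformulas of `A` (including `A`). -/
def sub : Formula P → Set (Formula P)
  | var p => {var p}
  | neg A => insert (neg A) (sub A)
  | imp A B => insert (imp A B) (sub A ∪ sub B)
  | disj A B => insert (disj A B) (sub A ∪ sub B)
  | conj A B => insert (conj A B) (sub A ∪ sub B)
  | up A => insert (up A) (sub A)
  | down A => insert (down A) (sub A)

/-- A Gödel numbering of the formulas, relative to a numbering of the variables. -/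
def code [Encodable P] : Formula P → ℕ
  | var p => Nat.pair 0 (Encodable.encode p)
  | neg A => Nat.pair 1 (code A)
  | imp A B => Nat.pair 2 (Nat.pair (code A) (code B))
  | disj A B => Nat.pair 3 (Nat.pair (code A) (code B))
  | conj A B => Nat.pair 4 (Nat.pair (code A) (code B))
  | up A => Nat.pair 5 (code A)
  | down A => Nat.pair 6 (code A)

theorem code_injective [Encodable P] : Function.Injective (code (P := P)) := by
  intro A
  induction A <;> intro B h <;> cases B <;> simp_all [code, Nat.pair_eq_pair] <;> grind

end Formula

open Formula

/-- Provability in IntGC: a Hilbert calculus for intuitionistic propositional logic with the rules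
of modus ponens, substitution, (GC1) and (GC2). -/
inductive Provable {P : Type u} : Formula P → Prop
  | imp_k (A B : Formula P) : Provable (imp A (imp B A))
  | imp_s (A B C : Formula P) :
      Provable (imp (imp A (imp B C)) (imp (imp A B) (imp A C)))
  | conj_left (A B : Formula P) : Provable (imp (conj A B) A)
  | conj_right (A B : Formula P) : Provable (imp (conj A B) B)
  | conj_intro (A B : Formula P) : Provable (imp A (imp B (conj A B)))
  | disj_left (A B : Formula P) : Provable (imp A (disj A B))
  | disj_right (A B : Formula P) : Provable (imp B (disj A B))
  | disj_elim (A B C : Formula P) :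
      Provable (imp (imp A C) (imp (imp B C) (imp (disj A B) C)))
  | neg_intro (A B : Formula P) :
      Provable (imp (imp A B) (imp (imp A (neg B)) (neg A)))
  | neg_elim (A B : Formula P) : Provable (imp (neg A) (imp A B))
  | subst (s : P → Formula P) {A : Formula P} : Provable A → Provable (A.subst s)
  | mp {A B : Formula P} : Provable (imp A B) → Provable A → Provable B
  | gc1 {A B : Formula P} : Provable (imp A (down B)) → Provable (imp (up A) B)
  | gc2 {A B : Formula P} : Provable (imp (up A) B) → Provable (imp A (down B))

/-- Kripke frames of IntGC: a preorder `le` on a non-empty set and a relation `R` such that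
`(≥ ∘ R ∘ ≥) ⊆ R`. -/
structure Frame where
  World : Type v
  nonempty : Nonempty World
  le : World → World → Prop
  le_refl : ∀ x, le x x
  le_trans : ∀ x y z, le x y → le y z → le x z
  R : World → World → Prop
  ge_R_ge : ∀ x y z w, le y x → R y z → le w z → R x w

/-- IntGC-models: a frame with a valuation of the variables by sets of worlds that are closed
upwards (persistence). -/
structure Model (P : Type u) extends Frame.{v} where
  val : P → Set World
  val_persistent : ∀ p x y, le x y → x ∈ val p → y ∈ val p

namespace Model

variable {P : Type u}

/-- The satisfiability relation `x ⊨ A`. -/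
def Sat (M : Model.{u, v} P) : M.World → Formula P → Prop
  | x, var p => x ∈ M.val p
  | x, neg A => ∀ y, M.le x y → ¬ M.Sat y A
  | x, imp A B => ∀ y, M.le x y → M.Sat y A → M.Sat y B
  | x, disj A B => M.Sat x A ∨ M.Sat x B
  | x, conj A B => M.Sat x A ∧ M.Sat x B
  | x, up A => ∃ y, M.R x y ∧ M.Sat y A
  | x, down A => ∀ y, M.R y x → M.Sat y A

/-- `A` is valid in the model. -/
def Valid (M : Model.{u, v} P) (A : Formula P) : Prop := ∀ x, M.Sat x A

/-- `x ∼ y`: the worlds `x` and `y` satisfy the same formulas of `S`. -/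
def filtSetoid (M : Model.{u, v} P) (S : Set (Formula P)) : Setoid M.World where
  r x y := ∀ B ∈ S, M.Sat x B ↔ M.Sat y B
  iseqv :=
    ⟨fun _ _ _ => Iff.rfl, fun h B hB => (h B hB).symm,
      fun h k B hB => (h B hB).trans (k B hB)⟩

/-- The filtration `(X/∼, ≤ᶠ, Rᶠ, vᶠ)` of a model through a set `S` of formulas:
* `[x] ≤ᶠ [y]` iff every `B ∈ S` with `x ⊨ B` has `y ⊨ B`;
* `[x] Rᶠ [y]` iff for every `B ∈ S` with `▽B ∈ S`, `y ⊨ ▽B` implies `x ⊨ B`;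
* `vᶠ(p) = {[x] | x ⊨ p}` for variables `p ∈ S` (and `∅` for the other variables).

The relations are stated for all representatives of the classes; since they depend on the classes
only, this is the same as stating them for some representatives (see `filtration_le_mk`,
`filtration_R_mk`, `filtration_val_mk`). -/
def filtration (M : Model.{u, v} P) (S : Set (Formula P)) : Model.{u, v} P where
  World := Quotient (M.filtSetoid S)
  nonempty := M.nonempty.map (Quotient.mk _)
  le a b := ∀ x y, Quotient.mk (M.filtSetoid S) x = a → Quotient.mk (M.filtSetoid S) y = b →
    ∀ B ∈ S, M.Sat x B → M.Sat y B
  le_refl a := by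
    intro x y hx hy B hB h
    exact (Quotient.exact (hx.trans hy.symm) B hB).1 h
  le_trans a b c hab hbc := by
    intro x z hx hz B hB h
    obtain ⟨y, hy⟩ := Quotient.exists_rep b
    exact hbc y z hy hz B hB (hab x y hx hy B hB h)
  R a b := ∀ x y, Quotient.mk (M.filtSetoid S) x = a → Quotient.mk (M.filtSetoid S) y = b →
    ∀ B ∈ S, down B ∈ S → M.Sat y (down B) → M.Sat x B
  ge_R_ge a b c d hba hbc hdc := by
    intro x w hx hw B hB hdB h
    obtain ⟨y, hy⟩ := Quotient.exists_rep b
    obtain ⟨z, hz⟩ := Quotient.exists_rep c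
    exact hba y x hy hx B hB (hbc y z hy hz B hB hdB (hdc w z hw hz _ hdB h))
  val p := {a | var p ∈ S ∧ ∃ x, Quotient.mk (M.filtSetoid S) x = a ∧ M.Sat x (var p)}
  val_persistent p a b hab := by
    rintro ⟨hp, x, hx, h⟩
    obtain ⟨y, hy⟩ := Quotient.exists_rep b
    exact ⟨hp, y, hy, hab x y hx hy _ hp h⟩

theorem filtration_le_mk (M : Model.{u, v} P) (S : Set (Formula P)) (x y : M.World) :
    (M.filtration S).le (Quotient.mk (M.filtSetoid S) x) (Quotient.mk (M.filtSetoid S) y) ↔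
      ∀ B ∈ S, M.Sat x B → M.Sat y B := by
  constructor
  · intro h
    exact h x y rfl rfl
  · intro h x' y' hx hy B hB hs
    exact (Quotient.exact hy B hB).2 (h B hB ((Quotient.exact hx B hB).1 hs))

theorem filtration_R_mk (M : Model.{u, v} P) (S : Set (Formula P)) (x y : M.World) :
    (M.filtration S).R (Quotient.mk (M.filtSetoid S) x) (Quotient.mk (M.filtSetoid S) y) ↔
      ∀ B ∈ S, down B ∈ S → M.Sat y (down B) → M.Sat x B := by
  constructor
  · intro h
    exact h x y rfl rfl
  · intro h x' y' hx hy B hB hdB hs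
    exact (Quotient.exact hx B hB).2 (h B hB hdB ((Quotient.exact hy _ hdB).1 hs))

theorem filtration_val_mk (M : Model.{u, v} P) (S : Set (Formula P)) (p : P) (hp : var p ∈ S)
    (x : M.World) :
    Quotient.mk (M.filtSetoid S) x ∈ (M.filtration S).val p ↔ M.Sat x (var p) := by
  constructor
  · rintro ⟨_, y, hy, h⟩
    exact (Quotient.exact hy _ hp).1 h
  · intro h
    exact ⟨hp, x, rfl, h⟩

end Model

variable {P : Type u}

/-- `Γ = Sub(A) ∪ {▽▲B | ▲B ∈ Sub(A)} ∪ {▲▽B | ▽B ∈ Sub(A)}`. -/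
def Gam (A : Formula P) : Set (Formula P) :=
  A.sub ∪ {C | ∃ B, up B ∈ A.sub ∧ C = down (up B)} ∪
    {C | ∃ B, down B ∈ A.sub ∧ C = up (down B)}

/-- The set `Σ`: `Sub(A)` together with all `(▽▲)ⁿ▽B` and `▲(▽▲)ⁿ▽B` with `▽B ∈ Γ`, and all
`(▲▽)ⁿ▲B` and `▽(▲▽)ⁿ▲B` with `▲B ∈ Γ`. -/
def Sig (A : Formula P) : Set (Formula P) :=
  A.sub ∪
    {C | ∃ (n : ℕ) (B : Formula P), down B ∈ Gam A ∧
      C = (fun D => down (up D))^[n] (down B)} ∪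
    {C | ∃ (n : ℕ) (B : Formula P), down B ∈ Gam A ∧
      C = up ((fun D => down (up D))^[n] (down B))} ∪
    {C | ∃ (n : ℕ) (B : Formula P), up B ∈ Gam A ∧
      C = (fun D => up (down D))^[n] (up B)} ∪
    {C | ∃ (n : ℕ) (B : Formula P), up B ∈ Gam A ∧
      C = down ((fun D => up (down D))^[n] (up B))}

/-- `S` is closed under subformulas. -/
def SubformulaClosed (S : Set (Formula P)) : Prop :=
  ∀ B ∈ S, ∀ C ∈ B.sub, C ∈ S

/-- The classes of provably equivalent formulas into which `S` is divided. -/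
def provClasses (S : Set (Formula P)) : Set (Set (Formula P)) :=
  (fun B => {C | C ∈ S ∧ Provable (equiv B C)}) '' S

/-- The finite model property: each formula that is not provable is refuted in a finite model. -/
def HasFMP (P : Type u) : Prop :=
  ∀ A : Formula P, ¬ Provable A → ∃ N : Model.{u, 0} P, Finite N.World ∧ ¬ N.Valid A

/-- Decidability: some total computable function decides, from the code of a formula, whether the
formula is provable. -/
def IsDecidable (P : Type u) [Encodable P] : Prop :=
  ∃ f : ℕ → Bool, Computable f ∧ ∀ A : Formula P, f A.code = true ↔ Provable A

end IntGC

namespace IntGC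

open Formula

variable {P : Type u}

/-! ### Soundness -/

namespace Model

/-! Completeness comes from a canonical model whose worlds are the prime theories. Its truth lemma
rests on extending a theory to a prime one that avoids a directed set (`IsTheory.exists_isPrime`);
the two Galois rules supply exactly what the cases of `up` and `down` need.

The canonical model is then filtered through `Sig A`. By the triangle identities ▽▲▽B ≡ ▽B and ▲▽▲B
≡ ▲B, this infinite set is finite up to provable equivalence, so by soundness there are finitely
many classes. The filtered relation is defined through ▽ alone, and the filtration still preserves ▲
because ▲B ∈ `Sig A` forces ▽▲B ∈ `Sig A` (`down_up_mem_Sig`, `filtration_sat`).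

Decidability does not pass through an enumeration of proofs, nor through the finite model property.
The worlds of any model refuting A, recorded by the formulas of code at most that of A which they
satisfy, form a finite family subject to local conditions; conversely, any family meeting these
conditions is a model. The search for a refuting family is bounded, hence primitive recursive. -/

theorem sat_mono (M : Model.{u, v} P) (A : Formula P) :
    ∀ {x y : M.World}, M.le x y → M.Sat x A → M.Sat y A := by
  induction A with
  | var p => exact fun {x y} h hx => M.val_persistent p x y h hx
  | neg A _ => exact fun h hx z hz => hx z (M.le_trans _ _ _ h hz)
  | imp A B _ _ => exact fun h hx z hz => hx z (M.le_trans _ _ _ h hz)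
  | disj A B hA hB => exact fun h hx => hx.imp (hA h) (hB h)
  | conj A B hA hB => exact fun h hx => ⟨hA h hx.1, hB h hx.2⟩
  | up A _ =>
    rintro x y h ⟨z, hz, hA⟩
    exact ⟨z, M.ge_R_ge _ _ _ _ h hz (M.le_refl z), hA⟩
  | down A _ => exact fun h hx z hz => hx z (M.ge_R_ge _ _ _ _ (M.le_refl z) hz h)

/-- The model in which each variable `p` is evaluated as the formula `s p`. -/
def substVal (M : Model.{u, v} P) (s : P → Formula P) : Model.{u, v} P where
  toFrame := M.toFrame
  val p := {x | M.Sat x (s p)}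
  val_persistent p _ _ h hx := M.sat_mono (s p) h hx

/-- Handles the substitution rule in the soundness proof: substituting in the formula amounts to
changing the valuation, which is legitimate because truth sets are upward closed. -/
theorem sat_substVal (M : Model.{u, v} P) (s : P → Formula P) (A : Formula P) :
    ∀ x : M.World, (M.substVal s).Sat x A ↔ M.Sat x (A.subst s) := by
  induction A with
  | var p => exact fun x => Iff.rfl
  | neg A hA => exact fun x => forall₂_congr fun y _ => not_congr (hA y)
  | imp A B hA hB => exact fun x => forall₂_congr fun y _ => imp_congr (hA y) (hB y)
  | disj A B hA hB => exact fun x => or_congr (hA x) (hB x)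
  | conj A B hA hB => exact fun x => and_congr (hA x) (hB x)
  | up A hA => exact fun x => exists_congr fun y => and_congr Iff.rfl (hA y)
  | down A hA => exact fun x => forall₂_congr fun y _ => hA y

end Model

/-- The model is quantified inside the induction, since the substitution case applies the hypothesis
to a different valuation. The Galois rules hold because ▲ looks forward along `R` and ▽ backward. -/
theorem Provable.sound {A : Formula P} (h : Provable A) :
    ∀ M : Model.{u, v} P, M.Valid A := by
  induction h with
  | imp_k A B => exact fun M x y _ hA z hz _ => M.sat_mono A hz hA
  | imp_s A B C =>
    exact fun M x y _ h₁ z hz h₂ w hw hA =>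
      h₁ w (M.le_trans _ _ _ hz hw) hA w (M.le_refl w) (h₂ w hw hA)
  | conj_left A B => exact fun M x y _ h => h.1
  | conj_right A B => exact fun M x y _ h => h.2
  | conj_intro A B => exact fun M x y _ hA z hz hB => ⟨M.sat_mono A hz hA, hB⟩
  | disj_left A B => exact fun M x y _ h => Or.inl h
  | disj_right A B => exact fun M x y _ h => Or.inr h
  | disj_elim A B C =>
    exact fun M x y _ h₁ z hz h₂ w hw h =>
      h.elim (h₁ w (M.le_trans _ _ _ hz hw)) (h₂ w hw)
  | neg_intro A B =>
    exact fun M x y _ h₁ z hz h₂ w hw hA =>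
      h₂ w hw hA w (M.le_refl w) (h₁ w (M.le_trans _ _ _ hz hw) hA)
  | neg_elim A B => exact fun M x y _ h z hz hA => (h z hz hA).elim
  | subst s _ ih => exact fun M x => (M.sat_substVal s _ x).1 (ih (M.substVal s) x)
  | mp _ _ ih₁ ih₂ => exact fun M x => ih₁ M x x (M.le_refl x) (ih₂ M x)
  | gc1 _ ih =>
    rintro M x y - ⟨z, hz, hA⟩
    exact ih M z z (M.le_refl z) hA y hz
  | gc2 _ ih => exact fun M x y _ hA z hz => ih M z z (M.le_refl z) ⟨y, hz, hA⟩

/-! ### Theories -/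

/-- A set of formulas that contains the provable ones and is closed under modus ponens. -/
structure IsTheory (T : Set (Formula P)) : Prop where
  provable : ∀ {A}, Provable A → A ∈ T
  mp : ∀ {A B}, imp A B ∈ T → A ∈ T → B ∈ T

/-- Makes every closure property of theories available for provability itself. -/
theorem isTheory_provable : IsTheory {A : Formula P | Provable A} :=
  ⟨id, Provable.mp⟩

namespace IsTheory

variable {T : Set (Formula P)} (hT : IsTheory T)
include hT

theorem mp_provable {A B : Formula P} (h : Provable (imp A B)) (hA : A ∈ T) : B ∈ T :=
  hT.mp (hT.provable h) hA

theorem imp_of_mem {A B : Formula P} (hB : B ∈ T) : imp A B ∈ T :=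
  hT.mp_provable (.imp_k B A) hB

theorem imp_mp {A B C : Formula P} (h : imp A (imp B C) ∈ T) (h' : imp A B ∈ T) :
    imp A C ∈ T :=
  hT.mp (hT.mp_provable (.imp_s A B C) h) h'

theorem imp_self (A : Formula P) : imp A A ∈ T :=
  hT.imp_mp (hT.provable (.imp_k A (imp A A))) (hT.provable (.imp_k A A))

theorem imp_trans {A B C : Formula P} (h : imp A B ∈ T) (h' : imp B C ∈ T) : imp A C ∈ T :=
  hT.imp_mp (hT.imp_of_mem h') h

theorem conj_mem {A B : Formula P} (hA : A ∈ T) (hB : B ∈ T) : conj A B ∈ T :=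
  hT.mp (hT.mp_provable (.conj_intro A B) hA) hB

theorem disj_elim_mem {A B C : Formula P} (hA : imp A C ∈ T) (hB : imp B C ∈ T)
    (h : disj A B ∈ T) : C ∈ T :=
  hT.mp (hT.mp (hT.mp_provable (.disj_elim A B C) hA) hB) h

/-- The theory generated by `T` and `A`. -/
theorem adjoin (A : Formula P) : IsTheory {B | imp A B ∈ T} :=
  ⟨fun h => hT.imp_of_mem (hT.provable h), hT.imp_mp⟩

theorem subset_adjoin (A : Formula P) : T ⊆ {B | imp A B ∈ T} :=
  fun _ h => hT.imp_of_mem h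

end IsTheory

namespace Provable

theorem imp_refl (A : Formula P) : Provable (imp A A) := isTheory_provable.imp_self A

theorem trans {A B C : Formula P} (h : Provable (imp A B)) (h' : Provable (imp B C)) :
    Provable (imp A C) := isTheory_provable.imp_trans h h'

theorem imp_down_up (A : Formula P) : Provable (imp A (down (up A))) := gc2 (imp_refl _)

theorem up_down_imp (A : Formula P) : Provable (imp (up (down A)) A) := gc1 (imp_refl _)

theorem up_mono {A B : Formula P} (h : Provable (imp A B)) : Provable (imp (up A) (up B)) :=
  gc1 (h.trans (imp_down_up B))

theorem down_mono {A B : Formula P} (h : Provable (imp A B)) :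
    Provable (imp (down A) (down B)) :=
  gc2 ((up_down_imp A).trans h)

theorem down_of {A : Formula P} (h : Provable A) : Provable (down A) :=
  (gc2 (isTheory_provable.imp_of_mem h : Provable (imp (up A) A))).mp h

/-- ▽ is a right adjoint, so it respects meets: by `gc2` it is enough to derive B from ▲ of the
conjunction, and `gc1` applied to the two projections gives A → B and A from it. -/
theorem conj_down (A B : Formula P) :
    Provable (imp (conj (down (imp A B)) (down A)) (down B)) := by
  refine gc2 (isTheory_provable.imp_mp (B := A) ?_ ?_)
  · exact gc1 (conj_left _ _)
  · exact gc1 (conj_right _ _)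

end Provable

theorem IsTheory.preimage_down {T : Set (Formula P)} (hT : IsTheory T) :
    IsTheory {B | down B ∈ T} :=
  ⟨fun h => hT.provable h.down_of,
    fun h h' => hT.mp_provable (.conj_down _ _) (hT.conj_mem h h')⟩

/-- A consistent theory with the disjunction property. -/
structure IsPrime (T : Set (Formula P)) : Prop extends IsTheory T where
  ne_univ : ∃ A, A ∉ T
  mem_or_mem : ∀ {A B}, disj A B ∈ T → A ∈ T ∨ B ∈ T

/-- A theory disjoint from a non-empty set directed by provable implication extends to a prime
theory disjoint from that set. -/
theorem IsTheory.exists_isPrime {T I : Set (Formula P)} (hT : IsTheory T) (hI : I.Nonempty)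
    (hdir : ∀ B ∈ I, ∀ C ∈ I, ∃ D ∈ I, Provable (imp B D) ∧ Provable (imp C D))
    (hTI : Disjoint T I) : ∃ U, T ⊆ U ∧ IsPrime U ∧ Disjoint U I := by
  obtain ⟨U, hTU, hU⟩ := zorn_subset_nonempty {U | IsTheory U ∧ Disjoint U I} (by
    rintro c hc hchain ⟨V, hV⟩
    refine ⟨⋃₀ c, ⟨⟨fun h => ⟨V, hV, (hc hV).1.provable h⟩, ?_⟩, ?_⟩,
      fun s hs => Set.subset_sUnion_of_mem hs⟩
    · rintro A B ⟨X, hX, h₁⟩ ⟨Y, hY, h₂⟩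
      rcases hchain.total hX hY with h | h
      · exact ⟨Y, hY, (hc hY).1.mp (h h₁) h₂⟩
      · exact ⟨X, hX, (hc hX).1.mp h₁ (h h₂)⟩
    · exact Set.disjoint_sUnion_left.2 fun s hs => (hc hs).2) T ⟨hT, hTI⟩
  obtain ⟨hUT, hUI⟩ := hU.prop
  -- By maximality, the theory generated by U and a formula outside U must meet I. Two such
  -- witnesses, for A and B, have a common upper bound in I, and this yields the disjunction
  -- property.
  have key : ∀ A, A ∉ U → ∃ D ∈ I, imp A D ∈ U := by
    intro A hA
    by_contra! hcon
    have hmem : {B | imp A B ∈ U} ∈ {U | IsTheory U ∧ Disjoint U I} :=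
      ⟨hUT.adjoin A, Set.disjoint_left.2 fun D hD hDI => hcon D hDI hD⟩
    exact hA (hU.le_of_ge hmem (hUT.subset_adjoin A) (hUT.imp_self A))
  refine ⟨U, hTU, ⟨hUT, ?_, ?_⟩, hUI⟩
  · exact hI.imp fun A hA hAU => Set.disjoint_left.1 hUI hAU hA
  · intro A B h
    by_contra! hcon
    obtain ⟨C, hC, hAC⟩ := key A hcon.1
    obtain ⟨D, hD, hBD⟩ := key B hcon.2
    obtain ⟨E, hE, hCE, hDE⟩ := hdir C hC D hD
    exact Set.disjoint_left.1 hUI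
      (hUT.disj_elim_mem (hUT.imp_trans hAC (hUT.provable hCE))
        (hUT.imp_trans hBD (hUT.provable hDE)) h) hE

theorem IsTheory.exists_isPrime_notMem {T : Set (Formula P)} (hT : IsTheory T) {A : Formula P}
    (hA : A ∉ T) : ∃ U, T ⊆ U ∧ IsPrime U ∧ A ∉ U := by
  obtain ⟨U, h₁, h₂, h₃⟩ := hT.exists_isPrime (Set.singleton_nonempty A)
    (by
      rintro _ rfl _ rfl
      exact ⟨_, rfl, .imp_refl _, .imp_refl _⟩)
    (Set.disjoint_singleton_right.2 hA)
  exact ⟨U, h₁, h₂, Set.disjoint_singleton_right.1 h₃⟩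

/-! ### Completeness -/

/-- The canonical model, whose worlds are the prime theories. -/
def canonicalModel (h : ∃ T : Set (Formula P), IsPrime T) : Model.{u, u} P where
  World := {T : Set (Formula P) // IsPrime T}
  nonempty := nonempty_subtype.2 h
  le x y := x.1 ⊆ y.1
  le_refl _ := subset_rfl
  le_trans _ _ _ := Set.Subset.trans
  R x y := ∀ B, down B ∈ y.1 → B ∈ x.1
  ge_R_ge _ _ _ _ h₁ h₂ h₃ B hB := h₁ (h₂ B (h₃ hB))
  val p := {x | var p ∈ x.1}
  val_persistent _ _ _ h hx := h hx

theorem canonicalModel_sat (h : ∃ T : Set (Formula P), IsPrime T) (A : Formula P) :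
    ∀ x : (canonicalModel h).World, (canonicalModel h).Sat x A ↔ A ∈ x.1 := by
  induction A with
  | var p => exact fun x => Iff.rfl
  | neg A hA =>
    intro x
    constructor
    · intro hx
      by_contra hneg
      -- If A → ¬A were in x, then `neg_intro` together with A → A would put ¬A in x. So the theory
      -- generated by x and A omits ¬A and has a prime extension.
      have : neg A ∉ {B | imp A B ∈ x.1} := fun hn => hneg <|
        x.2.mp (x.2.mp_provable (.neg_intro A A) (x.2.imp_self A)) hn
      obtain ⟨U, hU, hp, -⟩ := (x.2.adjoin A).exists_isPrime_notMem this
      exact hx ⟨U, hp⟩ ((x.2.subset_adjoin A).trans hU) ((hA ⟨U, hp⟩).2 (hU (x.2.imp_self A)))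
    · intro hx y hy hyA
      obtain ⟨B, hB⟩ := y.2.ne_univ
      exact hB (y.2.mp (y.2.mp_provable (.neg_elim A B) (hy hx)) ((hA y).1 hyA))
  | imp A B hA hB =>
    intro x
    constructor
    · intro hx
      by_contra hneg
      obtain ⟨U, hU, hp, hBU⟩ := (x.2.adjoin A).exists_isPrime_notMem (A := B) hneg
      exact hBU ((hB ⟨U, hp⟩).1 (hx ⟨U, hp⟩ ((x.2.subset_adjoin A).trans hU)
        ((hA ⟨U, hp⟩).2 (hU (x.2.imp_self A)))))
    · exact fun hx y hy hyA => (hB y).2 (y.2.mp (hy hx) ((hA y).1 hyA))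
  | disj A B hA hB =>
    intro x
    refine (or_congr (hA x) (hB x)).trans ⟨?_, x.2.mem_or_mem⟩
    rintro (h | h)
    · exact x.2.mp_provable (.disj_left A B) h
    · exact x.2.mp_provable (.disj_right A B) h
  | conj A B hA hB =>
    exact fun x => (and_congr (hA x) (hB x)).trans
      ⟨fun h => x.2.conj_mem h.1 h.2, fun h =>
        ⟨x.2.mp_provable (.conj_left A B) h, x.2.mp_provable (.conj_right A B) h⟩⟩
  | up A hA =>
    intro x
    constructor
    · rintro ⟨y, hxy, hy⟩
      exact hxy _ (y.2.mp_provable (.imp_down_up A) ((hA y).1 hy))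
    · intro hx
      -- The successor must contain A and omit ▽B for every B ∉ x. These ▽B are directed because x
      -- is prime and ▽ is monotone. No consequence of A is among them: A → ▽B gives ▲A → B, and ▲A
      -- ∈ x would force B ∈ x.
      obtain ⟨U, hU, hp, hd⟩ := (isTheory_provable.adjoin A).exists_isPrime
        (I := down '' x.1ᶜ) (Set.Nonempty.image _ x.2.ne_univ)
        (by
          rintro _ ⟨B, hB, rfl⟩ _ ⟨C, hC, rfl⟩
          exact ⟨_, ⟨disj B C, fun h => (x.2.mem_or_mem h).elim hB hC, rfl⟩,
            .down_mono (.disj_left B C), .down_mono (.disj_right B C)⟩)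
        (Set.disjoint_left.2 (by
          rintro _ h ⟨B, hB, rfl⟩
          exact hB (x.2.mp_provable (.gc1 h) hx)))
      refine ⟨⟨U, hp⟩, fun B hB => ?_, (hA ⟨U, hp⟩).2 (hU (isTheory_provable.imp_self A))⟩
      by_contra hBx
      exact Set.disjoint_left.1 hd hB ⟨B, hBx, rfl⟩
  | down A hA =>
    intro x
    constructor
    · intro hx
      by_contra hneg
      -- The formulas B with ▽B ∈ x form a theory; any prime extension of it is `R`-related to x,
      -- and one of them omits A.
      obtain ⟨U, hU, hp, hAU⟩ := x.2.preimage_down.exists_isPrime_notMem (A := A) hneg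
      exact hAU ((hA ⟨U, hp⟩).1 (hx ⟨U, hp⟩ fun B hB => hU hB))
    · exact fun hx y hy => (hA y).2 (hy A hx)

theorem exists_model_not_valid {A : Formula P} (hA : ¬ Provable A) :
    ∃ M : Model.{u, u} P, ¬ M.Valid A := by
  obtain ⟨U, -, hp, hAU⟩ := isTheory_provable.exists_isPrime_notMem (A := A) hA
  exact ⟨canonicalModel ⟨U, hp⟩, fun h => hAU ((canonicalModel_sat _ A ⟨U, hp⟩).1 (h _))⟩

/-! ### The set `Sig A` -/

namespace Formula

theorem self_mem_sub (A : Formula P) : A ∈ A.sub := by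
  cases A <;> simp [sub]

theorem sub_trans {A B C : Formula P} (hB : B ∈ A.sub) (hC : C ∈ B.sub) : C ∈ A.sub := by
  induction A with
  | var p =>
    obtain rfl : B = var p := hB
    exact hC
  | neg A ih | up A ih | down A ih =>
    rcases hB with rfl | hB
    · exact hC
    · exact .inr (ih hB)
  | imp A A' ih ih' | disj A A' ih ih' | conj A A' ih ih' =>
    rcases hB with rfl | hB | hB
    · exact hC
    · exact .inr (.inl (ih hB))
    · exact .inr (.inr (ih' hB))

theorem finite_sub (A : Formula P) : A.sub.Finite := by
  induction A with
  | var p => exact Set.finite_singleton _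
  | neg A ih | up A ih | down A ih => exact ih.insert _
  | imp A A' ih ih' | disj A A' ih ih' | conj A A' ih ih' => exact (ih.union ih').insert _

end Formula

theorem sub_subset_Sig (A : Formula P) : A.sub ⊆ Sig A :=
  fun _ h => .inl (.inl (.inl (.inl h)))

theorem sub_subset_Gam (A : Formula P) : A.sub ⊆ Gam A := fun _ h => .inl (.inl h)

theorem finite_Gam (A : Formula P) : (Gam A).Finite := by
  refine (A.finite_sub.union ((A.finite_sub.image down).subset ?_)).union
    ((A.finite_sub.image up).subset ?_)
  · rintro _ ⟨B, hB, rfl⟩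
    exact ⟨_, hB, rfl⟩
  · rintro _ ⟨B, hB, rfl⟩
    exact ⟨_, hB, rfl⟩

/-- The only ▽-formulas that `Gam A` adds are ▽▲C with ▲C already a subformula, so stripping the ▽
leads back into `A.sub`. -/
theorem mem_sub_of_down_mem_Gam {A B : Formula P} (h : down B ∈ Gam A) : B ∈ A.sub := by
  rcases h with (h | ⟨C, hC, h⟩) | ⟨C, -, h⟩
  · exact sub_trans h (.inr B.self_mem_sub)
  · cases h
    exact hC
  · cases h

theorem mem_sub_of_up_mem_Gam {A B : Formula P} (h : up B ∈ Gam A) : B ∈ A.sub := by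
  rcases h with (h | ⟨C, -, h⟩) | ⟨C, hC, h⟩
  · exact sub_trans h (.inr B.self_mem_sub)
  · cases h
  · cases h
    exact hC

theorem down_up_iterate_mem_Sig {A B : Formula P} (h : down B ∈ Gam A) (n : ℕ) :
    (fun D => down (up D))^[n] (down B) ∈ Sig A ∧
      up ((fun D => down (up D))^[n] (down B)) ∈ Sig A :=
  ⟨.inl (.inl (.inl (.inr ⟨n, B, h, rfl⟩))), .inl (.inl (.inr ⟨n, B, h, rfl⟩))⟩

theorem up_down_iterate_mem_Sig {A B : Formula P} (h : up B ∈ Gam A) (n : ℕ) :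
    (fun D => up (down D))^[n] (up B) ∈ Sig A ∧
      down ((fun D => up (down D))^[n] (up B)) ∈ Sig A :=
  ⟨.inl (.inr ⟨n, B, h, rfl⟩), .inr ⟨n, B, h, rfl⟩⟩

theorem sub_down_up_iterate_subset {A B : Formula P} (h : down B ∈ Gam A) (n : ℕ) :
    sub ((fun D => down (up D))^[n] (down B)) ⊆ Sig A := by
  induction n with
  | zero =>
    rintro C (rfl | hC)
    · exact (down_up_iterate_mem_Sig h 0).1
    · exact sub_subset_Sig A (sub_trans (mem_sub_of_down_mem_Gam h) hC)
  | succ n ih =>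
    rw [Function.iterate_succ_apply']
    rintro C (rfl | rfl | hC)
    · have := (down_up_iterate_mem_Sig h (n + 1)).1
      rwa [Function.iterate_succ_apply'] at this
    · exact (down_up_iterate_mem_Sig h n).2
    · exact ih hC

theorem sub_up_down_iterate_subset {A B : Formula P} (h : up B ∈ Gam A) (n : ℕ) :
    sub ((fun D => up (down D))^[n] (up B)) ⊆ Sig A := by
  induction n with
  | zero =>
    rintro C (rfl | hC)
    · exact (up_down_iterate_mem_Sig h 0).1
    · exact sub_subset_Sig A (sub_trans (mem_sub_of_up_mem_Gam h) hC)
  | succ n ih =>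
    rw [Function.iterate_succ_apply']
    rintro C (rfl | rfl | hC)
    · have := (up_down_iterate_mem_Sig h (n + 1)).1
      rwa [Function.iterate_succ_apply'] at this
    · exact (up_down_iterate_mem_Sig h n).2
    · exact ih hC

theorem subformulaClosed_Sig (A : Formula P) : SubformulaClosed (Sig A) := by
  rintro B ((((hB | ⟨n, D, hD, rfl⟩) | ⟨n, D, hD, rfl⟩) | ⟨n, D, hD, rfl⟩) | ⟨n, D, hD, rfl⟩) C hC
  · exact sub_subset_Sig A (sub_trans hB hC)
  · exact sub_down_up_iterate_subset hD n hC
  · rcases hC with rfl | hC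
    · exact (down_up_iterate_mem_Sig hD n).2
    · exact sub_down_up_iterate_subset hD n hC
  · exact sub_up_down_iterate_subset hD n hC
  · rcases hC with rfl | hC
    · exact (up_down_iterate_mem_Sig hD n).2
    · exact sub_up_down_iterate_subset hD n hC

/-- The closure property that makes ▲ survive filtration; the alternating strings are in `Sig` for
its sake. -/
theorem down_up_mem_Sig {A B : Formula P} (h : up B ∈ Sig A) : down (up B) ∈ Sig A := by
  rcases h with (((h | ⟨n, D, hD, h⟩) | ⟨n, D, hD, h⟩) | ⟨n, D, hD, h⟩) | ⟨n, D, hD, h⟩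
  · exact (up_down_iterate_mem_Sig (sub_subset_Gam A h) 0).2
  · cases n with
    | zero => cases h
    | succ n =>
      rw [Function.iterate_succ_apply'] at h
      cases h
  · rw [h]
    have := (down_up_iterate_mem_Sig hD (n + 1)).1
    rwa [Function.iterate_succ_apply'] at this
  · rw [h]
    exact (up_down_iterate_mem_Sig hD n).2
  · cases h

/-! ### Provable equivalence -/

theorem provable_equiv_iff {A B : Formula P} :
    Provable (equiv A B) ↔ Provable (imp A B) ∧ Provable (imp B A) :=
  ⟨fun h => ⟨.mp (.conj_left _ _) h, .mp (.conj_right _ _) h⟩,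
    fun h => isTheory_provable.conj_mem h.1 h.2⟩

namespace Provable

theorem equiv_refl (A : Formula P) : Provable (equiv A A) :=
  provable_equiv_iff.2 ⟨imp_refl A, imp_refl A⟩

theorem equiv_symm {A B : Formula P} (h : Provable (equiv A B)) : Provable (equiv B A) :=
  provable_equiv_iff.2 (provable_equiv_iff.1 h).symm

theorem equiv_trans {A B C : Formula P} (h : Provable (equiv A B)) (h' : Provable (equiv B C)) :
    Provable (equiv A C) := by
  rw [provable_equiv_iff] at *
  exact ⟨h.1.trans h'.1, h'.2.trans h.2⟩

theorem equiv_up {A B : Formula P} (h : Provable (equiv A B)) :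
    Provable (equiv (up A) (up B)) := by
  rw [provable_equiv_iff] at *
  exact ⟨h.1.up_mono, h.2.up_mono⟩

theorem equiv_down {A B : Formula P} (h : Provable (equiv A B)) :
    Provable (equiv (down A) (down B)) := by
  rw [provable_equiv_iff] at *
  exact ⟨h.1.down_mono, h.2.down_mono⟩

/-- A triangle identity of the Galois connection: one direction is the counit under ▽, the other the
unit at ▽A. -/
theorem down_up_down_equiv (A : Formula P) :
    Provable (equiv (down (up (down A))) (down A)) :=
  provable_equiv_iff.2 ⟨(up_down_imp A).down_mono, imp_down_up (down A)⟩

theorem up_down_up_equiv (A : Formula P) : Provable (equiv (up (down (up A))) (up A)) :=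
  provable_equiv_iff.2 ⟨up_down_imp (up A), (imp_down_up A).up_mono⟩

theorem down_up_iterate_equiv (A : Formula P) (n : ℕ) :
    Provable (equiv ((fun D => down (up D))^[n] (down A)) (down A)) := by
  induction n with
  | zero => exact equiv_refl _
  | succ n ih =>
    rw [Function.iterate_succ_apply']
    exact ih.equiv_up.equiv_down.equiv_trans (down_up_down_equiv A)

theorem up_down_iterate_equiv (A : Formula P) (n : ℕ) :
    Provable (equiv ((fun D => up (down D))^[n] (up A)) (up A)) := by
  induction n with
  | zero => exact equiv_refl _
  | succ n ih =>
    rw [Function.iterate_succ_apply']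
    exact ih.equiv_down.equiv_up.equiv_trans (up_down_up_equiv A)

theorem sat_congr {A B : Formula P} (h : Provable (equiv A B)) (M : Model.{u, v} P)
    (x : M.World) : M.Sat x A ↔ M.Sat x B := by
  rw [provable_equiv_iff] at h
  exact ⟨h.1.sound M x x (M.le_refl x), h.2.sound M x x (M.le_refl x)⟩

end Provable

/-- Up to provable equivalence, `Sig A` is finite. -/
theorem exists_finite_equiv_Sig (A : Formula P) :
    ∃ F : Set (Formula P), F.Finite ∧ ∀ B ∈ Sig A, ∃ C ∈ F, Provable (equiv B C) := by
  -- Every alternating string collapses to its innermost modal formula, which lies in `Gam A`, with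
  -- at most one further modality in front.
  refine ⟨Gam A ∪ up '' Gam A ∪ down '' Gam A,
    ((finite_Gam A).union ((finite_Gam A).image _)).union ((finite_Gam A).image _), ?_⟩
  rintro B ((((hB | ⟨n, D, hD, rfl⟩) | ⟨n, D, hD, rfl⟩) | ⟨n, D, hD, rfl⟩) | ⟨n, D, hD, rfl⟩)
  · exact ⟨B, .inl (.inl (sub_subset_Gam A hB)), .equiv_refl B⟩
  · exact ⟨_, .inl (.inl hD), .down_up_iterate_equiv D n⟩
  · exact ⟨_, .inl (.inr ⟨_, hD, rfl⟩), (Provable.down_up_iterate_equiv D n).equiv_up⟩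
  · exact ⟨_, .inl (.inl hD), .up_down_iterate_equiv D n⟩
  · exact ⟨_, .inr ⟨_, hD, rfl⟩, (Provable.up_down_iterate_equiv D n).equiv_down⟩

theorem finite_provClasses_Sig (A : Formula P) : (provClasses (Sig A)).Finite := by
  obtain ⟨F, hF, h⟩ := exists_finite_equiv_Sig A
  refine (hF.image fun B => {C | C ∈ Sig A ∧ Provable (equiv B C)}).subset ?_
  rintro _ ⟨B, hB, rfl⟩
  obtain ⟨C, hC, hBC⟩ := h B hB
  refine ⟨C, hC, Set.ext fun D => and_congr_right fun _ => ?_⟩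
  exact ⟨hBC.equiv_trans, hBC.equiv_symm.equiv_trans⟩

/-! ### Filtration -/

namespace Model

/-- The filtered relation only transfers truth from ▽B to B. For ▲ it is applied with B := ▲A, which
is why `hup` is assumed. -/
theorem filtration_sat (M : Model.{u, v} P) {S : Set (Formula P)} (hS : SubformulaClosed S)
    (hup : ∀ B, up B ∈ S → down (up B) ∈ S) (A : Formula P) (hA : A ∈ S) :
    ∀ x : M.World, (M.filtration S).Sat (Quotient.mk (M.filtSetoid S) x) A ↔ M.Sat x A := by
  have hmk : ∀ {x y : M.World}, M.le x y → (M.filtration S).le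
      (Quotient.mk (M.filtSetoid S) x) (Quotient.mk (M.filtSetoid S) y) := fun {x y} h =>
    (M.filtration_le_mk S x y).2 fun B _ => M.sat_mono B h
  have hmkR : ∀ {x y : M.World}, M.R x y → (M.filtration S).R
      (Quotient.mk (M.filtSetoid S) x) (Quotient.mk (M.filtSetoid S) y) := fun {x y} h =>
    (M.filtration_R_mk S x y).2 fun B _ _ hy => hy x h
  induction A with
  | var p => exact M.filtration_val_mk S p hA
  | neg A ih =>
    have ih := ih (hS _ hA _ (.inr A.self_mem_sub))
    refine fun x => ⟨fun h y hy hyA => h _ (hmk hy) ((ih y).2 hyA), fun h => ?_⟩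
    refine Quotient.ind fun y hy hyA => ?_
    -- The negation itself belongs to S, so it passes from x to y along the filtered order and is
    -- then tested at y; implication works alike.
    exact (M.filtration_le_mk S x y).1 hy _ hA h y (M.le_refl y) ((ih y).1 hyA)
  | imp A B ihA ihB =>
    have ihA := ihA (hS _ hA _ (.inr (.inl A.self_mem_sub)))
    have ihB := ihB (hS _ hA _ (.inr (.inr B.self_mem_sub)))
    refine fun x => ⟨fun h y hy hyA => (ihB y).1 (h _ (hmk hy) ((ihA y).2 hyA)), fun h => ?_⟩
    refine Quotient.ind fun y hy hyA => (ihB y).2 ?_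
    exact (M.filtration_le_mk S x y).1 hy _ hA h y (M.le_refl y) ((ihA y).1 hyA)
  | disj A B ihA ihB =>
    exact fun x => or_congr (ihA (hS _ hA _ (.inr (.inl A.self_mem_sub))) x)
      (ihB (hS _ hA _ (.inr (.inr B.self_mem_sub))) x)
  | conj A B ihA ihB =>
    exact fun x => and_congr (ihA (hS _ hA _ (.inr (.inl A.self_mem_sub))) x)
      (ihB (hS _ hA _ (.inr (.inr B.self_mem_sub))) x)
  | up A ih =>
    have ih := ih (hS _ hA _ (.inr A.self_mem_sub))
    refine fun x => ⟨?_, fun ⟨y, hy, hyA⟩ => ⟨_, hmkR hy, (ih y).2 hyA⟩⟩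
    rintro ⟨y, hy, hyA⟩
    induction y using Quotient.ind with | _ y
    -- Since y satisfies A, every z with z R y satisfies ▲A; so y satisfies ▽▲A, and the filtered
    -- relation returns ▲A at x.
    exact (M.filtration_R_mk S x y).1 hy _ hA (hup _ hA) fun z hz => ⟨y, hz, (ih y).1 hyA⟩
  | down A ih =>
    have hAS := hS _ hA _ (.inr A.self_mem_sub)
    have ih := ih hAS
    refine fun x => ⟨fun h y hy => (ih y).1 (h _ (hmkR hy)), fun h => ?_⟩
    exact Quotient.ind fun y hy => (ih y).2 ((M.filtration_R_mk S y x).1 hy A hAS hA h)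

/-- A class is determined by which formulas of a finite set of representatives hold in it, because
provably equivalent formulas hold at the same worlds. -/
theorem finite_filtration_Sig (M : Model.{u, v} P) (A : Formula P) :
    Finite (M.filtration (Sig A)).World := by
  obtain ⟨F, hF, h⟩ := exists_finite_equiv_Sig A
  have := hF.to_subtype
  refine Finite.of_injective (β := Set F)
    (fun a : Quotient (M.filtSetoid (Sig A)) => {C : F | M.Sat a.out C}) fun a b hab => ?_
  rw [← a.out_eq, ← b.out_eq]
  refine Quotient.sound fun B hB => ?_
  obtain ⟨C, hC, hBC⟩ := h B hB
  rw [hBC.sat_congr M, hBC.sat_congr M]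
  exact Set.ext_iff.1 hab ⟨C, hC⟩

theorem filtration_Sig_not_valid (M : Model.{u, v} P) {A : Formula P} (h : ¬ M.Valid A) :
    ¬ (M.filtration (Sig A)).Valid A := fun hv => h fun x =>
  (M.filtration_sat (subformulaClosed_Sig A) (fun _ => down_up_mem_Sig) A
    (sub_subset_Sig A A.self_mem_sub) x).1 (hv _)

/-- Transport of a model along a bijection of its worlds. -/
def transport {W : Type*} (M : Model.{u, v} P) (e : W ≃ M.World) : Model P where
  World := W
  nonempty := M.nonempty.map e.symm
  le x y := M.le (e x) (e y)
  le_refl x := M.le_refl (e x)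
  le_trans x y z := M.le_trans (e x) (e y) (e z)
  R x y := M.R (e x) (e y)
  ge_R_ge x y z w := M.ge_R_ge (e x) (e y) (e z) (e w)
  val p := {x | e x ∈ M.val p}
  val_persistent p x y := M.val_persistent p (e x) (e y)

theorem transport_sat {W : Type*} (M : Model.{u, v} P) (e : W ≃ M.World) (A : Formula P) :
    ∀ x : W, (M.transport e).Sat x A ↔ M.Sat (e x) A := by
  induction A with
  | var p => exact fun x => Iff.rfl
  | neg A hA => exact fun x => e.forall_congr fun y => imp_congr Iff.rfl (not_congr (hA y))
  | imp A B hA hB =>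
    exact fun x => e.forall_congr fun y => imp_congr Iff.rfl (imp_congr (hA y) (hB y))
  | disj A B hA hB => exact fun x => or_congr (hA x) (hB x)
  | conj A B hA hB => exact fun x => and_congr (hA x) (hB x)
  | up A hA => exact fun x => e.exists_congr fun y => and_congr Iff.rfl (hA y)
  | down A hA => exact fun x => e.forall_congr fun y => imp_congr Iff.rfl (hA y)

end Model

theorem hasFMP (P : Type u) : HasFMP P := by
  intro A hA
  obtain ⟨M, hM⟩ := exists_model_not_valid hA
  have := M.finite_filtration_Sig A
  -- Copying the worlds onto some `Fin k` brings the model down to universe 0, as `HasFMP` requires.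
  let e := (Finite.equivFin (M.filtration (Sig A)).World).symm
  refine ⟨(M.filtration (Sig A)).transport e, inferInstanceAs (Finite (Fin _)), fun h => ?_⟩
  refine M.filtration_Sig_not_valid hM fun x => ?_
  simpa using (Model.transport_sat _ e A (e.symm x)).1 (h _)

/-! ### Primitive recursive predicates -/

section Primrec

variable {α : Type*} [Primcodable α]

theorem primrecPred_imp {p q : α → Prop} (hp : PrimrecPred p) (hq : PrimrecPred q) :
    PrimrecPred fun a => p a → q a :=
  (hp.not.or hq).of_eq fun _ => imp_iff_not_or.symm

theorem primrecPred_iff {p q : α → Prop} (hp : PrimrecPred p) (hq : PrimrecPred q) :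
    PrimrecPred fun a => p a ↔ q a :=
  ((primrecPred_imp hp hq).and (primrecPred_imp hq hp)).of_eq fun _ =>
    iff_iff_implies_and_implies.symm

theorem primrecPred_forall_lt_bound {p : α → ℕ → Prop} {f : α → ℕ} (hf : Primrec f)
    (hp : PrimrecPred fun q : α × ℕ => p q.1 q.2) : PrimrecPred fun a => ∀ x < f a, p a x :=
  ((PrimrecRel.forall_mem_list (R := fun x a => p a x)
    (hp.comp (Primrec.snd.pair Primrec.fst))).comp (Primrec.list_range.comp hf) Primrec.id).of_eq
    (by simp)

theorem primrecPred_exists_lt_bound {p : α → ℕ → Prop} {f : α → ℕ} (hf : Primrec f)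
    (hp : PrimrecPred fun q : α × ℕ => p q.1 q.2) : PrimrecPred fun a => ∃ x < f a, p a x :=
  ((PrimrecRel.exists_mem_list (R := fun x a => p a x)
    (hp.comp (Primrec.snd.pair Primrec.fst))).comp (Primrec.list_range.comp hf) Primrec.id).of_eq
    (by simp)

theorem primrec_two_pow {f : α → ℕ} (hf : Primrec f) : Primrec fun a => 2 ^ f a := by
  have : Primrec fun n : ℕ => 2 ^ n :=
    (Primrec.nat_rec₁ 1 (Primrec.nat_mul.comp Primrec.snd (Primrec.const 2)).to₂).of_eq fun n => by
      induction n with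
      | zero => rfl
      | succ n ih => rw [pow_succ, ← ih]
  exact this.comp hf

theorem primrecPred_testBit {f g : α → ℕ} (hf : Primrec f) (hg : Primrec g) :
    PrimrecPred fun a => (f a).testBit (g a) = true :=
  (Primrec.eq.comp (Primrec.nat_mod.comp (Primrec.nat_div.comp hf (primrec_two_pow hg))
    (Primrec.const 2)) (Primrec.const 1)).of_eq fun a => by
      simp [Nat.testBit_eq_decide_div_mod_eq]

end Primrec

/-! ### Models coded by numbers

A world is coded by the number whose binary digits tell which formulas with code less than `n`
hold in it, a model by the number whose binary digits tell which worlds it has. -/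

/-- Inclusion of the sets of formulas with code less than `n` coded by `w` and `w'`. -/
def MaskLe (n w w' : ℕ) : Prop := ∀ b < n, w.testBit b → w'.testBit b

/-- The largest relation compatible with `▲` and `▽` on the formulas with code less than `n`. -/
def MaskR (n w w' : ℕ) : Prop :=
  ∀ b < n, (Nat.pair 6 b < n → w'.testBit (Nat.pair 6 b) → w.testBit b) ∧
    (Nat.pair 5 b < n → w'.testBit b → w.testBit (Nat.pair 5 b))

/-- The truth conditions for unary connectives. -/
def UnaryClauses (n W w a : ℕ) : Prop :=
  (Nat.pair 1 a < n → (w.testBit (Nat.pair 1 a) ↔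
    ∀ w' < 2 ^ n, W.testBit w' → MaskLe n w w' → ¬ w'.testBit a)) ∧
  (Nat.pair 5 a < n → (w.testBit (Nat.pair 5 a) ↔
    ∃ w' < 2 ^ n, W.testBit w' ∧ MaskR n w w' ∧ w'.testBit a)) ∧
  (Nat.pair 6 a < n → (w.testBit (Nat.pair 6 a) ↔
    ∀ w' < 2 ^ n, W.testBit w' → MaskR n w' w → w'.testBit a))

/-- The truth conditions for binary connectives. -/
def BinaryClauses (n W w a b : ℕ) : Prop :=
  (Nat.pair 2 (Nat.pair a b) < n → (w.testBit (Nat.pair 2 (Nat.pair a b)) ↔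
    ∀ w' < 2 ^ n, W.testBit w' → MaskLe n w w' → w'.testBit a → w'.testBit b)) ∧
  (Nat.pair 3 (Nat.pair a b) < n → (w.testBit (Nat.pair 3 (Nat.pair a b)) ↔
    w.testBit a ∨ w.testBit b)) ∧
  (Nat.pair 4 (Nat.pair a b) < n → (w.testBit (Nat.pair 4 (Nat.pair a b)) ↔
    w.testBit a ∧ w.testBit b))

/-- `W` codes a model for the formulas with code less than `n`. -/
def CodesModel (n W : ℕ) : Prop :=
  ∀ w < 2 ^ n, W.testBit w →
    ∀ a < n, UnaryClauses n W w a ∧ ∀ b < n, BinaryClauses n W w a b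

/-- Some coded model refutes the formula with code `c`. -/
def Refutable (c : ℕ) : Prop :=
  ∃ W < 2 ^ 2 ^ (c + 1), CodesModel (c + 1) W ∧
    ∃ w < 2 ^ (c + 1), W.testBit w ∧ ¬ w.testBit c

/-! ### Refutability is primitive recursive. -/

section Primrec

variable {α : Type*} [Primcodable α] {n W w w' a b : α → ℕ}

open Primrec

theorem primrec_pair_const (k : ℕ) (ha : Primrec a) : Primrec fun x => Nat.pair k (a x) :=
  Primrec₂.natPair.comp (const k) ha

theorem primrecPred_maskLe (hn : Primrec n) (hw : Primrec w) (hw' : Primrec w') :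
    PrimrecPred fun x => MaskLe (n x) (w x) (w' x) :=
  primrecPred_forall_lt_bound hn <|
    primrecPred_imp (primrecPred_testBit (hw.comp fst) snd) (primrecPred_testBit (hw'.comp fst) snd)

theorem primrecPred_maskR (hn : Primrec n) (hw : Primrec w) (hw' : Primrec w') :
    PrimrecPred fun x => MaskR (n x) (w x) (w' x) := by
  have h₅ := primrec_pair_const 5 (snd (α := α) (β := ℕ))
  have h₆ := primrec_pair_const 6 (snd (α := α) (β := ℕ))
  refine primrecPred_forall_lt_bound hn (PrimrecPred.and ?_ ?_)
  · exact primrecPred_imp (nat_lt.comp h₆ (hn.comp fst)) <|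
      primrecPred_imp (primrecPred_testBit (hw'.comp fst) h₆) (primrecPred_testBit (hw.comp fst) snd)
  · exact primrecPred_imp (nat_lt.comp h₅ (hn.comp fst)) <|
      primrecPred_imp (primrecPred_testBit (hw'.comp fst) snd) (primrecPred_testBit (hw.comp fst) h₅)

theorem primrecPred_unaryClauses (hn : Primrec n) (hW : Primrec W) (hw : Primrec w)
    (ha : Primrec a) : PrimrecPred fun x => UnaryClauses (n x) (W x) (w x) (a x) := by
  have h (k : ℕ) {q : α → Prop} (hq : PrimrecPred q) : PrimrecPred fun x =>
      Nat.pair k (a x) < n x → ((w x).testBit (Nat.pair k (a x)) ↔ q x) :=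
    primrecPred_imp (nat_lt.comp (primrec_pair_const k ha) hn)
      (primrecPred_iff (primrecPred_testBit hw (primrec_pair_const k ha)) hq)
  have hW' : PrimrecPred fun q : α × ℕ => (W q.1).testBit q.2 = true :=
    primrecPred_testBit (hW.comp fst) snd
  have ha' : PrimrecPred fun q : α × ℕ => q.2.testBit (a q.1) = true :=
    primrecPred_testBit snd (ha.comp fst)
  refine PrimrecPred.and (h 1 ?_) (PrimrecPred.and (h 5 ?_) (h 6 ?_))
  · exact primrecPred_forall_lt_bound (primrec_two_pow hn) <| primrecPred_imp hW' <|
      primrecPred_imp (primrecPred_maskLe (hn.comp fst) (hw.comp fst) snd) ha'.not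
  · exact primrecPred_exists_lt_bound (primrec_two_pow hn) <| hW'.and <|
      (primrecPred_maskR (hn.comp fst) (hw.comp fst) snd).and ha'
  · exact primrecPred_forall_lt_bound (primrec_two_pow hn) <| primrecPred_imp hW' <|
      primrecPred_imp (primrecPred_maskR (hn.comp fst) snd (hw.comp fst)) ha'

theorem primrecPred_binaryClauses (hn : Primrec n) (hW : Primrec W) (hw : Primrec w)
    (ha : Primrec a) (hb : Primrec b) :
    PrimrecPred fun x => BinaryClauses (n x) (W x) (w x) (a x) (b x) := by
  have hab (k : ℕ) := primrec_pair_const k (Primrec₂.natPair.comp ha hb)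
  have h (k : ℕ) {q : α → Prop} (hq : PrimrecPred q) : PrimrecPred fun x =>
      Nat.pair k (Nat.pair (a x) (b x)) < n x →
        ((w x).testBit (Nat.pair k (Nat.pair (a x) (b x))) ↔ q x) :=
    primrecPred_imp (nat_lt.comp (hab k) hn)
      (primrecPred_iff (primrecPred_testBit hw (hab k)) hq)
  refine PrimrecPred.and (h 2 ?_) (PrimrecPred.and (h 3 ?_) (h 4 ?_))
  · exact primrecPred_forall_lt_bound (primrec_two_pow hn) <|
      primrecPred_imp (primrecPred_testBit (hW.comp fst) snd) <|
      primrecPred_imp (primrecPred_maskLe (hn.comp fst) (hw.comp fst) snd) <|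
      primrecPred_imp (primrecPred_testBit snd (ha.comp fst))
        (primrecPred_testBit snd (hb.comp fst))
  · exact (primrecPred_testBit hw ha).or (primrecPred_testBit hw hb)
  · exact (primrecPred_testBit hw ha).and (primrecPred_testBit hw hb)

theorem primrecPred_codesModel (hn : Primrec n) (hW : Primrec W) :
    PrimrecPred fun x => CodesModel (n x) (W x) := by
  refine primrecPred_forall_lt_bound (primrec_two_pow hn) <|
    primrecPred_imp (primrecPred_testBit (hW.comp fst) snd) <|
    primrecPred_forall_lt_bound (hn.comp fst) <| PrimrecPred.and ?_ ?_
  · exact primrecPred_unaryClauses (hn.comp (fst.comp fst)) (hW.comp (fst.comp fst))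
      (snd.comp fst) snd
  · exact primrecPred_forall_lt_bound (hn.comp (fst.comp fst)) <|
      primrecPred_binaryClauses (hn.comp (fst.comp (fst.comp fst)))
        (hW.comp (fst.comp (fst.comp fst))) (snd.comp (fst.comp fst)) (snd.comp fst) snd

/-- All quantifiers are bounded: with n = c + 1, so that c itself is covered, worlds are numbers
below 2 ^ n and sets of worlds numbers below 2 ^ 2 ^ n. -/
theorem primrecPred_refutable : PrimrecPred Refutable := by
  refine primrecPred_exists_lt_bound (primrec_two_pow (primrec_two_pow succ)) <|
    (primrecPred_codesModel (succ.comp fst) snd).and <|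
    primrecPred_exists_lt_bound (primrec_two_pow (succ.comp fst)) <| PrimrecPred.and ?_ ?_
  · exact primrecPred_testBit (snd.comp fst) snd
  · exact (primrecPred_testBit snd (fst.comp fst)).not

end Primrec

/-! ### Refutable formulas are not provable -/

/-- The frame condition holds for arbitrary masks, so `codedModel` is a model even before the truth
conditions are imposed. -/
theorem MaskR.of_le {n x y z w : ℕ} (h₁ : MaskLe n y x) (h₂ : MaskR n y z)
    (h₃ : MaskLe n w z) : MaskR n x w := fun b hb =>
  ⟨fun h hw => h₁ b hb ((h₂ b hb).1 h (h₃ _ h hw)),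
    fun h hw => h₁ _ h ((h₂ b hb).2 h (h₃ b hb hw))⟩

/-- The model coded by a number. -/
def codedModel (P : Type u) [Encodable P] (n W : ℕ) (h : ∃ w < 2 ^ n, W.testBit w) :
    Model.{u, 0} P where
  World := {w : ℕ // w < 2 ^ n ∧ W.testBit w}
  nonempty := nonempty_subtype.2 h
  le x y := MaskLe n x y
  le_refl _ _ _ h := h
  le_trans _ _ _ h₁ h₂ b hb h := h₂ b hb (h₁ b hb h)
  R x y := MaskR n x y
  ge_R_ge _ _ _ _ := MaskR.of_le
  val p := {x | Nat.pair 0 (Encodable.encode p) < n ∧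
    x.1.testBit (Nat.pair 0 (Encodable.encode p))}
  val_persistent _ _ _ h hx := ⟨hx.1, h _ hx.1 hx.2⟩

/-- The clauses in `CodesModel` are the induction steps of this truth lemma. Pairing dominates both
components, so the codes of subformulas stay below n. -/
theorem codedModel_sat [Encodable P] {n W : ℕ} (h : ∃ w < 2 ^ n, W.testBit w)
    (hW : CodesModel n W) (A : Formula P) (hA : A.code < n) :
    ∀ x : (codedModel P n W h).World,
      (codedModel P n W h).Sat x A ↔ x.1.testBit A.code := by
  induction A with
  | var p => exact fun x => and_iff_right hA
  | neg A ih =>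
    have hA' : A.code < n := (Nat.right_le_pair _ _).trans_lt hA
    intro x
    refine Iff.trans ?_ (((hW x.1 x.2.1 x.2.2 _ hA').1.1 hA).symm)
    exact ⟨fun h w h₁ h₂ hle hw => h ⟨w, h₁, h₂⟩ hle ((ih hA' _).2 hw),
      fun h y hy hyA => h y.1 y.2.1 y.2.2 hy ((ih hA' y).1 hyA)⟩
  | imp A B ihA ihB =>
    have hAB := (Nat.right_le_pair _ _).trans_lt hA
    have hA' : A.code < n := (Nat.left_le_pair _ _).trans_lt hAB
    have hB' : B.code < n := (Nat.right_le_pair _ _).trans_lt hAB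
    intro x
    refine Iff.trans ?_ (((hW x.1 x.2.1 x.2.2 _ hA').2 _ hB').1 hA).symm
    exact ⟨fun h w h₁ h₂ hle hw => (ihB hB' _).1 (h ⟨w, h₁, h₂⟩ hle ((ihA hA' _).2 hw)),
      fun h y hy hyA => (ihB hB' y).2 (h y.1 y.2.1 y.2.2 hy ((ihA hA' y).1 hyA))⟩
  | disj A B ihA ihB =>
    have hAB := (Nat.right_le_pair _ _).trans_lt hA
    have hA' : A.code < n := (Nat.left_le_pair _ _).trans_lt hAB
    have hB' : B.code < n := (Nat.right_le_pair _ _).trans_lt hAB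
    exact fun x => (or_congr (ihA hA' x) (ihB hB' x)).trans
      (((hW x.1 x.2.1 x.2.2 _ hA').2 _ hB').2.1 hA).symm
  | conj A B ihA ihB =>
    have hAB := (Nat.right_le_pair _ _).trans_lt hA
    have hA' : A.code < n := (Nat.left_le_pair _ _).trans_lt hAB
    have hB' : B.code < n := (Nat.right_le_pair _ _).trans_lt hAB
    exact fun x => (and_congr (ihA hA' x) (ihB hB' x)).trans
      (((hW x.1 x.2.1 x.2.2 _ hA').2 _ hB').2.2 hA).symm
  | up A ih =>
    have hA' : A.code < n := (Nat.right_le_pair _ _).trans_lt hA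
    intro x
    refine Iff.trans ?_ (((hW x.1 x.2.1 x.2.2 _ hA').1.2.1 hA).symm)
    exact ⟨fun ⟨y, hy, hyA⟩ => ⟨y.1, y.2.1, y.2.2, hy, (ih hA' y).1 hyA⟩,
      fun ⟨w, h₁, h₂, hR, hw⟩ => ⟨⟨w, h₁, h₂⟩, hR, (ih hA' _).2 hw⟩⟩
  | down A ih =>
    have hA' : A.code < n := (Nat.right_le_pair _ _).trans_lt hA
    intro x
    refine Iff.trans ?_ (((hW x.1 x.2.1 x.2.2 _ hA').1.2.2 hA).symm)
    exact ⟨fun h w h₁ h₂ hR => (ih hA' _).1 (h ⟨w, h₁, h₂⟩ hR),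
      fun h y hy => (ih hA' y).2 (h y.1 y.2.1 y.2.2 hy)⟩

theorem Refutable.not_provable [Encodable P] {A : Formula P} (h : Refutable A.code) :
    ¬ Provable A := by
  obtain ⟨W, -, hW, w, hw, hWw, hwA⟩ := h
  intro hA
  exact hwA ((codedModel_sat ⟨w, hw, hWw⟩ hW A (Nat.lt_succ_self _) ⟨w, hw, hWw⟩).1
    (hA.sound _ _))

/-! ### Unprovable formulas are refutable -/

/-- The decrease is strict because the tag is nonzero; this makes the recursion in `ofCode`
terminate. -/
theorem unpair_snd_lt {c : ℕ} (h : c.unpair.1 ≠ 0) : c.unpair.2 < c := by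
  have := Nat.add_le_pair c.unpair.1 c.unpair.2
  rw [Nat.pair_unpair] at this
  omega

/-- Every number read as the code of a formula, where the numbers that do not code a compound
formula are taken as variables. -/
def ofCode (c : ℕ) : Formula ℕ :=
  if _h : c.unpair.1 = 1 then neg (ofCode c.unpair.2)
  else if _h : c.unpair.1 = 2 then
    imp (ofCode c.unpair.2.unpair.1) (ofCode c.unpair.2.unpair.2)
  else if _h : c.unpair.1 = 3 then
    disj (ofCode c.unpair.2.unpair.1) (ofCode c.unpair.2.unpair.2)
  else if _h : c.unpair.1 = 4 then
    conj (ofCode c.unpair.2.unpair.1) (ofCode c.unpair.2.unpair.2)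
  else if _h : c.unpair.1 = 5 then up (ofCode c.unpair.2)
  else if _h : c.unpair.1 = 6 then down (ofCode c.unpair.2)
  else var c
termination_by c
decreasing_by
  all_goals first
    | exact unpair_snd_lt (by omega)
    | exact (Nat.unpair_left_le _).trans_lt (unpair_snd_lt (by omega))
    | exact (Nat.unpair_right_le _).trans_lt (unpair_snd_lt (by omega))

theorem ofCode_var (p : ℕ) : ofCode (Nat.pair 0 p) = var (Nat.pair 0 p) := by
  rw [ofCode]; simp

theorem ofCode_neg (a : ℕ) : ofCode (Nat.pair 1 a) = neg (ofCode a) := by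
  rw [ofCode]; simp

theorem ofCode_imp (a b : ℕ) :
    ofCode (Nat.pair 2 (Nat.pair a b)) = imp (ofCode a) (ofCode b) := by
  rw [ofCode]; simp

theorem ofCode_disj (a b : ℕ) :
    ofCode (Nat.pair 3 (Nat.pair a b)) = disj (ofCode a) (ofCode b) := by
  rw [ofCode]; simp

theorem ofCode_conj (a b : ℕ) :
    ofCode (Nat.pair 4 (Nat.pair a b)) = conj (ofCode a) (ofCode b) := by
  rw [ofCode]; simp

theorem ofCode_up (a : ℕ) : ofCode (Nat.pair 5 a) = up (ofCode a) := by
  rw [ofCode]; simp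

theorem ofCode_down (a : ℕ) : ofCode (Nat.pair 6 a) = down (ofCode a) := by
  rw [ofCode]; simp

/-! ### Reading a code off an arbitrary model. -/

namespace Model

/-- The model with the same frame in which the code of a variable is evaluated as that variable. -/
def codeVal [Encodable P] (M : Model.{u, v} P) : Model.{0, v} ℕ where
  toFrame := M.toFrame
  val q := {x | ∃ p, q = Nat.pair 0 (Encodable.encode p) ∧ x ∈ M.val p}
  val_persistent _ _ _ h := fun ⟨p, hp, hx⟩ => ⟨p, hp, M.val_persistent p _ _ h hx⟩

theorem codeVal_sat [Encodable P] (M : Model.{u, v} P) (A : Formula P) :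
    ∀ x : M.World, M.codeVal.Sat x (ofCode A.code) ↔ M.Sat x A := by
  induction A with
  | var p =>
    intro x
    rw [code, ofCode_var]
    constructor
    · rintro ⟨q, hq, hx⟩
      rw [Nat.pair_eq_pair] at hq
      rwa [Encodable.encode_injective hq.2]
    · exact fun hx => ⟨p, rfl, hx⟩
  | neg A hA =>
    rw [code, ofCode_neg]
    exact fun x => forall₂_congr fun y _ => not_congr (hA y)
  | imp A B hA hB =>
    rw [code, ofCode_imp]
    exact fun x => forall₂_congr fun y _ => imp_congr (hA y) (hB y)
  | disj A B hA hB =>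
    rw [code, ofCode_disj]
    exact fun x => or_congr (hA x) (hB x)
  | conj A B hA hB =>
    rw [code, ofCode_conj]
    exact fun x => and_congr (hA x) (hB x)
  | up A hA =>
    rw [code, ofCode_up]
    exact fun x => exists_congr fun y => and_congr Iff.rfl (hA y)
  | down A hA =>
    rw [code, ofCode_down]
    exact fun x => forall₂_congr fun y _ => hA y

variable (M : Model.{0, v} ℕ) (n : ℕ)

open Classical in
/-- The code of a world. -/
noncomputable def mask (x : M.World) : ℕ :=
  Nat.ofBits fun i : Fin n => decide (M.Sat x (ofCode i))

open Classical in
/-- The code of a model. -/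
noncomputable def modelMask : ℕ :=
  Nat.ofBits fun w : Fin (2 ^ n) => decide (∃ x, M.mask n x = w)

theorem mask_lt (x : M.World) : M.mask n x < 2 ^ n := Nat.ofBits_lt_two_pow _

theorem modelMask_lt : M.modelMask n < 2 ^ 2 ^ n := Nat.ofBits_lt_two_pow _

variable {n}

theorem testBit_mask {b : ℕ} (hb : b < n) (x : M.World) :
    (M.mask n x).testBit b ↔ M.Sat x (ofCode b) := by
  simp [mask, Nat.testBit_ofBits_lt _ _ hb]

theorem testBit_modelMask {w : ℕ} (hw : w < 2 ^ n) :
    (M.modelMask n).testBit w ↔ ∃ x, M.mask n x = w := by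
  simp [modelMask, Nat.testBit_ofBits_lt _ _ hw]

theorem testBit_modelMask_mask (x : M.World) : (M.modelMask n).testBit (M.mask n x) :=
  (M.testBit_modelMask (M.mask_lt n x)).2 ⟨x, rfl⟩

theorem maskLe_mask {x y : M.World} (h : M.le x y) : MaskLe n (M.mask n x) (M.mask n y) :=
  fun _ hb hx => (M.testBit_mask hb y).2 (M.sat_mono _ h ((M.testBit_mask hb x).1 hx))

theorem maskR_mask {x y : M.World} (h : M.R x y) : MaskR n (M.mask n x) (M.mask n y) := by
  refine fun _ hb => ⟨fun hb' hy => ?_, fun hb' hy => ?_⟩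
  · rw [testBit_mask M hb', ofCode_down] at hy
    exact (M.testBit_mask hb x).2 (hy x h)
  · rw [testBit_mask M hb', ofCode_up]
    exact ⟨y, h, (M.testBit_mask hb y).1 hy⟩

/-- Distinct worlds may share a mask, but every coded world comes from a world of M, so quantifiers
over the two agree. -/
theorem forall_modelMask {p : ℕ → Prop} :
    (∀ w < 2 ^ n, (M.modelMask n).testBit w → p w) ↔ ∀ x, p (M.mask n x) := by
  refine ⟨fun h x => h _ (M.mask_lt n x) (M.testBit_modelMask_mask x), fun h w hw hWw => ?_⟩
  obtain ⟨x, rfl⟩ := (M.testBit_modelMask hw).1 hWw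
  exact h x

theorem exists_modelMask {p : ℕ → Prop} :
    (∃ w < 2 ^ n, (M.modelMask n).testBit w ∧ p w) ↔ ∃ x, p (M.mask n x) := by
  refine ⟨fun ⟨w, hw, hWw, h⟩ => ?_, fun ⟨x, h⟩ => ⟨_, M.mask_lt n x,
    M.testBit_modelMask_mask x, h⟩⟩
  obtain ⟨x, rfl⟩ := (M.testBit_modelMask hw).1 hWw
  exact ⟨x, h⟩

/-- The filtration argument again. It must hold for every number a < n, whether or not a codes a
formula over the given variables, hence the use of `ofCode`. As `MaskR` mentions both ▲ and ▽, no
closure under ▽▲ is needed. -/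
theorem unaryClauses_mask (x : M.World) {a : ℕ} (ha : a < n) :
    UnaryClauses n (M.modelMask n) (M.mask n x) a := by
  refine ⟨fun hc => ?_, fun hc => ?_, fun hc => ?_⟩
  · rw [forall_modelMask, testBit_mask M hc, ofCode_neg]
    refine ⟨fun h y hy hya => ?_, fun h y hy hya =>
      h y (M.maskLe_mask hy) ((M.testBit_mask ha y).2 hya)⟩
    have := (M.testBit_mask hc y).1 (hy _ hc ((M.testBit_mask hc x).2 (by rwa [ofCode_neg])))
    rw [ofCode_neg] at this
    exact this y (M.le_refl y) ((M.testBit_mask ha y).1 hya)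
  · rw [exists_modelMask, testBit_mask M hc, ofCode_up]
    refine ⟨fun ⟨y, hy, hya⟩ => ⟨y, M.maskR_mask hy, (M.testBit_mask ha y).2 hya⟩, ?_⟩
    rintro ⟨y, hy, hya⟩
    have := (M.testBit_mask hc x).1 ((hy a ha).2 hc hya)
    rwa [ofCode_up] at this
  · rw [forall_modelMask, testBit_mask M hc, ofCode_down]
    refine ⟨fun h y hy => (hy a ha).1 hc ((M.testBit_mask hc x).2 (by rwa [ofCode_down])),
      fun h y hy => (M.testBit_mask ha y).1 (h y (M.maskR_mask hy))⟩

theorem binaryClauses_mask (x : M.World) {a b : ℕ} (ha : a < n) (hb : b < n) :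
    BinaryClauses n (M.modelMask n) (M.mask n x) a b := by
  refine ⟨fun hc => ?_, fun hc => ?_, fun hc => ?_⟩
  · rw [forall_modelMask, testBit_mask M hc, ofCode_imp]
    refine ⟨fun h y hy hya => ?_, fun h y hy hya =>
      (M.testBit_mask hb y).1 (h y (M.maskLe_mask hy) ((M.testBit_mask ha y).2 hya))⟩
    have := (M.testBit_mask hc y).1 (hy _ hc ((M.testBit_mask hc x).2 (by rwa [ofCode_imp])))
    rw [ofCode_imp] at this
    exact (M.testBit_mask hb y).2 (this y (M.le_refl y) ((M.testBit_mask ha y).1 hya))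
  · rw [testBit_mask M hc, testBit_mask M ha, testBit_mask M hb, ofCode_disj]
    rfl
  · rw [testBit_mask M hc, testBit_mask M ha, testBit_mask M hb, ofCode_conj]
    rfl

theorem codesModel_modelMask : CodesModel n (M.modelMask n) :=
  M.forall_modelMask.2 fun x _ ha =>
    ⟨M.unaryClauses_mask x ha, fun _ hb => M.binaryClauses_mask x ha hb⟩

end Model

/-- The refuting model may be infinite; passing to masks makes it finite and bounds its code. -/
theorem refutable_of_not_provable [Encodable P] {A : Formula P} (hA : ¬ Provable A) :
    Refutable A.code := by
  obtain ⟨M, hM⟩ := exists_model_not_valid hA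
  obtain ⟨x, hx⟩ := not_forall.1 hM
  refine ⟨M.codeVal.modelMask _, M.codeVal.modelMask_lt _, M.codeVal.codesModel_modelMask,
    M.codeVal.mask _ x, M.codeVal.mask_lt _ x, M.codeVal.testBit_modelMask_mask x, fun h => hx ?_⟩
  exact (M.codeVal_sat A x).1 ((M.codeVal.testBit_mask (Nat.lt_succ_self _) x).1 h)

theorem isDecidable (P : Type u) [Encodable P] : IsDecidable P := by
  classical
  -- The decision function is the same for all P, because `Refutable` sees only the code.
  refine ⟨fun c => decide (¬ Refutable c), primrecPred_refutable.not.decide.to_comp, fun A => ?_⟩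
  rw [decide_eq_true_iff]
  exact ⟨fun h => by_contra fun hA => h (refutable_of_not_provable hA),
    fun h hr => hr.not_provable h⟩

end IntGC

theorem proposition3p8 (P : Type u) [Encodable P] :
    IntGC.HasFMP P ∧
    (∀ A : IntGC.Formula P,
      A ∈ IntGC.Sig A ∧
      IntGC.SubformulaClosed (IntGC.Sig A) ∧
      (IntGC.provClasses (IntGC.Sig A)).Finite ∧
      ∀ M : IntGC.Model.{u, v} P, ¬ M.Valid A →
        Finite (M.filtration (IntGC.Sig A)).World ∧ ¬ (M.filtration (IntGC.Sig A)).Valid A) ∧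
    IntGC.IsDecidable P :=
  ⟨IntGC.hasFMP P, fun A =>
    ⟨IntGC.sub_subset_Sig A A.self_mem_sub, IntGC.subformulaClosed_Sig A,
      IntGC.finite_provClasses_Sig A,
      fun M h => ⟨M.finite_filtration_Sig A, M.filtration_Sig_not_valid h⟩⟩,
    IntGC.isDecidable P⟩
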